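/- Let $m\ge n\ge 0$ and $B,\Delta B\in\mathbb C^{m\times n}$, and put $B(t)=B+t\,\Delta B$ for $t\in\mathbb R$ and $\widetilde B=B(1)=B+\Delta B$. Let $r_1,\dots,r_k\ge 0$ be integers with $r_1+\dots+r_k=n$. Suppose that for all $t\in\mathbb R$ $$B(t)=W(t)\begin{bmatrix}\Sigma(t)\\0\end{bmatrix}V(t)^H,\qquad \Sigma(t)=\operatorname{diag}(\Sigma_1(t),\dots,\Sigma_k(t)),$$ where $\Sigma_j(t)\in\mathbb C^{r_j\times r_j}$ (not necessarily diagonal), the matrices $W(t)=[W_1(t),\dots,W_k(t),W_{k+1}(t)]\in\mathbb C^{m\times m}$ and $V(t)=[V_1(t),\dots,V_k(t)]\in\mathbb C^{n\times n}$ are unitary, with $W_j(t)\in\mathbb C^{m\times r_j}$ and $V_j(t)\in\mathbb C^{n\times r_j}$ for $j\le k$ and $W_{k+1}(t)\in\mathbb C^{m\times(m-n)}$, all entries of $\Sigma_j$, $W$, $V$ are real-analytic functions of $t\in\mathbb R$, and for all $t\in\mathbb R$ $$W_j(t)^H\dot W_j(t)=0\quad(1\le j\le k+1),\qquad V_j(t)^H\dot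 V_j(t)=0\quad(1\le j\le k).$$ Write $\sigma(A)$ for the set of singular values of a matrix $A$ and, for an $A$ with $n$ columns and at least $n$ rows, $\operatorname{Sing}^{\downarrow}(A)$ for the $n\times n$ diagonal matrix whose diagonal entries are the singular values of $A$ in nonincreasing order. For $1\le i,j\le k$ define $$\rho_{ji}(t)=\min_{\sigma_1\in\sigma(\Sigma_j(t)),\,\sigma_2\in\sigma(\Sigma_i(t))}|\sigma_1-\sigma_2|,\qquad \rho_j(t)=\min_{i\ne j}\rho_{ji}(t),\qquad \sigma_{j,\min}(t)=\min\sigma(\Sigma_j(t)),$$ $$\widehat\rho_j(t)=\min\{\rho_j(t),\sigma_{j,\min}(t)\},\qquad \sigma_{\min}(t)=\min_{j}\sigma_{j,\min}(t),$$ $$\rho_{j,\min}=\min_{0\le t\le1}\rho_j(t),\qquad \widehat\rho_{j,\min}=\min_{0\le t\le1}\widehat\rho_j(t),\qquad \sigma_{\min}=\min_{0\le t\le1}\sigma_{\min}(t),$$ where a minimum over the empty set is $+\infty$ (for instance $\rho_1(t)=+\infty$ if $k=1$) and $\infty\cdot 0=0$. Put $W_j=W_j(0)$, $\widetilde W_j=W_j(1)$,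 $V_j=V_j(0)$, $\widetilde V_j=V_j(1)$. Then $$\|\operatorname{Sing}^{\downarrow}(\widetilde B)-\operatorname{Sing}^{\downarrow}(B)\|_F^2+\sum_{j=1}^k\frac{\widehat\rho_{j,\min}^{\,2}}2\|\widetilde W_j-W_j\|_F^2+\frac{\sigma_{\min}^2}2\|\widetilde W_{k+1}-W_{k+1}\|_F^2+\sum_{j=1}^k\frac{\rho_{j,\min}^2}2\|\widetilde V_j-V_j\|_F^2\le\|\Delta B\|_F^2 .$$ Moreover, if $m=n$, then $$\|\operatorname{Sing}^{\downarrow}(\widetilde B)-\operatorname{Sing}^{\downarrow}(B)\|_F^2+\sum_{j=1}^k\frac{\rho_{j,\min}^2}2\left(\|\widetilde W_j-W_j\|_F^2+\|\widetilde V_j-V_j\|_F^2\right)\le\|\Delta B\|_F^2 .$$ -/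

import Mathlib

open scoped ENNReal Matrix Matrix.Norms.Frobenius

namespace CombinedSVD

noncomputable section

/-- The `i`-th singular value (in nonincreasing order, starting from `i = 0`) of a complex matrix
with `n` columns and at least `n` rows. -/
def singularValue {m n : ℕ} (A : Matrix (Fin m) (Fin n) ℂ) (i : Fin n) : ℝ :=
  (Matrix.toEuclideanLin A).singularValues i

/-- The set `σ(A)` of singular values of a complex matrix with at least as many rows as columns. -/
def singularSet {m n : ℕ} (A : Matrix (Fin m) (Fin n) ℂ) : Set ℝ :=
  Set.range (singularValue A)

/-- `Sing↓(A)`: the `n × n` diagonal matrix of the singular values in nonincreasing order. -/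
def singDown {m n : ℕ} (A : Matrix (Fin m) (Fin n) ℂ) : Matrix (Fin n) (Fin n) ℝ :=
  Matrix.diagonal (singularValue A)

/-- A matrix function of a real variable is analytic if all its entries are real-analytic. -/
def IsAnalytic {ι κ : Type*} (F : ℝ → Matrix ι κ ℂ) : Prop :=
  ∀ a b, ∀ t : ℝ, AnalyticAt ℝ (fun s => F s a b) t

/-- The entrywise derivative of a matrix function of a real variable. -/
def matDeriv {ι κ : Type*} (F : ℝ → Matrix ι κ ℂ) (t : ℝ) : Matrix ι κ ℂ :=
  Matrix.of fun a b => deriv (fun s => F s a b) t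

/-- The matrix `[M₁, …, M_k]` obtained by putting the blocks `M_j` side by side. -/
def blockRow {d k : ℕ} {r : Fin k → ℕ} (M : (j : Fin k) → Matrix (Fin d) (Fin (r j)) ℂ) :
    Matrix (Fin d) ((j : Fin k) × Fin (r j)) ℂ :=
  Matrix.of fun a p => M p.1 a p.2

/-- A rectangular matrix of size `ι × κ` is unitary if its conjugate transpose is a two-sided
inverse (so the two index types have the same number of elements). -/
def IsUnitary {ι κ : Type*} [Fintype ι] [Fintype κ] [DecidableEq ι] [DecidableEq κ]
    (U : Matrix ι κ ℂ) : Prop :=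
  Uᴴ * U = 1 ∧ U * Uᴴ = 1

/-- `B + t ΔB = W(t) [Σ(t); 0] V(t)ᴴ` for all real `t`, where
`Σ(t) = diag(Σ₁(t), …, Σ_k(t))`, and `W(t) = [W₁(t), …, W_k(t), W_{k+1}(t)]`,
`V(t) = [V₁(t), …, V_k(t)]` are unitary, everything is analytic in `t`, and
`W_jᴴ Ẇ_j = 0` for `j = 1, …, k+1` and `V_jᴴ V̇_j = 0` for `j = 1, …, k`.
The block `W_{k+1}` is called `Wlast`. -/
structure IsAnalyticFactorization {m n k : ℕ} {r : Fin k → ℕ}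
    (B ΔB : Matrix (Fin m) (Fin n) ℂ)
    (W : (j : Fin k) → ℝ → Matrix (Fin m) (Fin (r j)) ℂ)
    (Wlast : ℝ → Matrix (Fin m) (Fin (m - n)) ℂ)
    (S : (j : Fin k) → ℝ → Matrix (Fin (r j)) (Fin (r j)) ℂ)
    (V : (j : Fin k) → ℝ → Matrix (Fin n) (Fin (r j)) ℂ) : Prop where
  analytic_W : ∀ j, IsAnalytic (W j)
  analytic_Wlast : IsAnalytic Wlast
  analytic_S : ∀ j, IsAnalytic (S j)
  analytic_V : ∀ j, IsAnalytic (V j)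
  unitary_W : ∀ t, IsUnitary (Matrix.fromCols (blockRow fun j => W j t) (Wlast t))
  unitary_V : ∀ t, IsUnitary (blockRow fun j => V j t)
  factorization : ∀ t : ℝ, B + t • ΔB =
    Matrix.fromCols (blockRow fun j => W j t) (Wlast t)
      * Matrix.fromRows (Matrix.blockDiagonal' fun j => S j t)
          (0 : Matrix (Fin (m - n)) ((j : Fin k) × Fin (r j)) ℂ)
      * (blockRow fun j => V j t)ᴴ
  orth_W : ∀ j t, (W j t)ᴴ * matDeriv (W j) t = 0
  orth_Wlast : ∀ t, (Wlast t)ᴴ * matDeriv Wlast t = 0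
  orth_V : ∀ j t, (V j t)ᴴ * matDeriv (V j) t = 0

section Gaps

/-! The gaps take values in `[0, ∞]`, so that a minimum over an empty family is `∞`
(for instance `ρ_j` when there is only one block). -/

variable {k : ℕ} {r : Fin k → ℕ} (S : (j : Fin k) → ℝ → Matrix (Fin (r j)) (Fin (r j)) ℂ)

/-- `ρ_{ji}(t)`. -/
def rhoPair (j i : Fin k) (t : ℝ) : ℝ≥0∞ :=
  ⨅ x ∈ singularSet (S j t), ⨅ y ∈ singularSet (S i t), ENNReal.ofReal |x - y|

/-- `ρ_j(t)`. -/
def rho (j : Fin k) (t : ℝ) : ℝ≥0∞ :=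
  ⨅ i : Fin k, ⨅ _ : i ≠ j, rhoPair S j i t

/-- `σ_{j,min}(t)`. -/
def sigmaBlock (j : Fin k) (t : ℝ) : ℝ≥0∞ :=
  ⨅ x ∈ singularSet (S j t), ENNReal.ofReal x

/-- `ρ̂_j(t)`. -/
def rhoHat (j : Fin k) (t : ℝ) : ℝ≥0∞ :=
  min (rho S j t) (sigmaBlock S j t)

/-- `σ_min(t)`. -/
def sigma (t : ℝ) : ℝ≥0∞ :=
  ⨅ j : Fin k, sigmaBlock S j t

/-- `ρ_{j,min}`. -/
def rhoMin (j : Fin k) : ℝ≥0∞ :=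
  ⨅ t ∈ Set.Icc (0 : ℝ) 1, rho S j t

/-- `ρ̂_{j,min}`. -/
def rhoHatMin (j : Fin k) : ℝ≥0∞ :=
  ⨅ t ∈ Set.Icc (0 : ℝ) 1, rhoHat S j t

/-- `σ_min`. -/
def sigmaMin : ℝ≥0∞ :=
  ⨅ t ∈ Set.Icc (0 : ℝ) 1, sigma S t

end Gaps

end

end CombinedSVD

/-! Differentiating `B(t) V_i = W_i S_i` and multiplying on the left by each block of `W(t)ᴴ` cuts
`W(t)ᴴ ΔB V(t)` into blocks. With `X_ji = W_jᴴ Ẇ_i`, `Y_ji = V_jᴴ V̇_i` and `Z_i = W_{k+1}ᴴ Ẇ_i`,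
the conditions `W_iᴴ Ẇ_i = 0` and `V_iᴴ V̇_i = 0` turn the diagonal blocks into `Ṡ_i`; the
off-diagonal ones are `X_ji S_i - S_j Y_ji`, and those of the last block row are `Z_i S_i`.

Since `X_ij = -X_jiᴴ` and `Y_ij = -Y_jiᴴ`, the blocks `(j, i)` and `(i, j)` together form a coupled
Sylvester operator in `(X_ji, Y_ji)`, bounded below by the gap between the singular values of `S_j`
and `S_i` (`frobSq_sylvester_ge`). The last row is bounded below by the smallest singular values
(`frobSq_mul_ge`). Summing over ordered pairs counts every off-diagonal block twice, and the last
row serves both `Ẇ_i` and `Ẇ_{k+1}`: this is the origin of the factors 1/2 in `frobSq_deriv_le`.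

Integrating over `[0, 1]`, Cauchy-Schwarz replaces derivatives by increments. Mirsky's inequality
for `diag(S_j(0))` and `diag(S_j(1))`, which have the singular values of `B` and `B + ΔB`, handles
the first term. Infinite gaps are reached as limits of finite weights. -/

namespace CombinedSVD

open Matrix

/-! ### Singular values and the singular value decomposition -/

section SingularValues

theorem singularValue_nonneg {m n : ℕ} (A : Matrix (Fin m) (Fin n) ℂ) (i : Fin n) :
    0 ≤ singularValue A i :=
  LinearMap.singularValues_nonneg _ _

theorem singularValue_antitone {m n : ℕ} (A : Matrix (Fin m) (Fin n) ℂ) :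
    Antitone (singularValue A) :=
  fun _ _ hij => LinearMap.singularValues_antitone _ hij

theorem adjoint_comp_toEuclideanLin {m n : ℕ} (A : Matrix (Fin m) (Fin n) ℂ) :
    LinearMap.adjoint (toEuclideanLin A) ∘ₗ toEuclideanLin A = toEuclideanLin (Aᴴ * A) := by
  rw [← Matrix.toEuclideanLin_conjTranspose_eq_adjoint]
  ext x i
  simp [Matrix.toLpLin_apply]

theorem charpoly_toEuclideanLin {n : ℕ} (A : Matrix (Fin n) (Fin n) ℂ) :
    (toEuclideanLin A).charpoly = A.charpoly := by
  rw [toEuclideanLin_eq_toLin_orthonormal, Matrix.charpoly_toLin]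

/-- The singular values of `A` only depend on the characteristic polynomial of `Aᴴ * A`. -/
theorem singularValue_eq_of_charpoly_eq {m p n : ℕ} {A : Matrix (Fin m) (Fin n) ℂ}
    {C : Matrix (Fin p) (Fin n) ℂ} (h : (Aᴴ * A).charpoly = (Cᴴ * C).charpoly) :
    singularValue A = singularValue C := by
  have hn : Module.finrank ℂ (EuclideanSpace ℂ (Fin n)) = n := by simp
  funext i
  have := (LinearMap.IsSymmetric.eigenvalues_eq_eigenvalues_iff
    (toEuclideanLin A).isSymmetric_adjoint_comp_self hn
    (toEuclideanLin C).isSymmetric_adjoint_comp_self hn).2 (by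
      rw [adjoint_comp_toEuclideanLin, adjoint_comp_toEuclideanLin, charpoly_toEuclideanLin,
        charpoly_toEuclideanLin, h])
  rw [singularValue, singularValue, LinearMap.singularValues_fin _ hn,
    LinearMap.singularValues_fin _ hn, this]

/-- Singular value decomposition of a square matrix. -/
theorem exists_svd {n : ℕ} (A : Matrix (Fin n) (Fin n) ℂ) :
    ∃ U V : Matrix (Fin n) (Fin n) ℂ, IsUnitary U ∧ IsUnitary V ∧
      A = U * diagonal (fun i => (singularValue A i : ℂ)) * Vᴴ := by
  have hn : Module.finrank ℂ (EuclideanSpace ℂ (Fin n)) = n := by simp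
  set T := toEuclideanLin A with hT
  set v := T.isSymmetric_adjoint_comp_self.eigenvectorBasis hn with hv
  have hTT : ∀ i j, inner ℂ (T (v i)) (T (v j)) =
      if i = j then ((singularValue A i : ℂ)) ^ 2 else 0 := by
    intro i j
    have h1 := T.isSymmetric_adjoint_comp_self.apply_eigenvectorBasis hn i
    rw [← LinearMap.adjoint_inner_left]
    rw [← hv] at h1
    have h2 : (LinearMap.adjoint T) (T (v i)) = (LinearMap.adjoint T ∘ₗ T) (v i) := rfl
    rw [h2, h1, inner_smul_left, ← LinearMap.sq_singularValues_fin T hn i,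
      orthonormal_iff_ite.1 v.orthonormal i j]
    split_ifs <;> simp [singularValue, hT]
  -- Only the vectors with nonzero singular value can be normalised; the extension to a basis
  -- supplies the other left singular vectors.
  let s : Set (Fin n) := {i | singularValue A i ≠ 0}
  have hs : Orthonormal ℂ (s.domRestrict fun i => ((singularValue A i : ℂ))⁻¹ • T (v i)) := by
    rw [orthonormal_iff_ite]
    rintro ⟨i, hi⟩ ⟨j, hj⟩
    have hi' : (singularValue A i : ℂ) ≠ 0 := by exact_mod_cast hi
    simp only [Set.domRestrict_apply, inner_smul_left, inner_smul_right, hTT, Subtype.mk.injEq]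
    split_ifs with hij
    · subst hij
      simp only [map_inv₀, Complex.conj_ofReal]
      field_simp
    · simp
  obtain ⟨u, hu⟩ := hs.exists_orthonormalBasis_extension_of_card_eq (by simp)
  have hTv : ∀ i, T (v i) = (singularValue A i : ℂ) • u i := by
    intro i
    by_cases hi : singularValue A i = 0
    · have := hTT i i
      rw [if_pos rfl, hi] at this
      simp only [Complex.ofReal_zero, ne_eq, OfNat.ofNat_ne_zero, not_false_eq_true, zero_pow,
        inner_self_eq_zero] at this
      simp [this, hi]
    · have hi' : (singularValue A i : ℂ) ≠ 0 := by exact_mod_cast hi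
      rw [hu i hi, smul_smul, mul_inv_cancel₀ hi', one_smul]
  have hunit : ∀ b : OrthonormalBasis (Fin n) ℂ (EuclideanSpace ℂ (Fin n)),
      IsUnitary (Matrix.of fun a i => b i a) := by
    intro b
    have h1 : (Matrix.of fun a i => b i a)ᴴ * (Matrix.of fun a i => b i a) = 1 := by
      ext i j
      have := orthonormal_iff_ite.1 b.orthonormal i j
      rw [PiLp.inner_apply] at this
      simp only [RCLike.inner_apply] at this
      simp only [mul_apply, conjTranspose_apply, of_apply, one_apply, ← this]
      exact Finset.sum_congr rfl fun x _ => mul_comm _ _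
    exact ⟨h1, mul_eq_one_comm.1 h1⟩
  refine ⟨Matrix.of fun a i => u i a, Matrix.of fun a i => v i a, hunit u, hunit v, ?_⟩
  have key : A * (Matrix.of fun a i => v i a) =
      (Matrix.of fun a i => u i a) * diagonal (fun i => (singularValue A i : ℂ)) := by
    ext a i
    have := congrArg (fun x : EuclideanSpace ℂ (Fin n) => x a) (hTv i)
    simp only [hT, Matrix.toLpLin_apply, PiLp.smul_apply, smul_eq_mul] at this
    rw [mul_diagonal, of_apply, mul_comm, ← this]
    simp [mul_apply, mulVec, dotProduct]
  rw [← key, Matrix.mul_assoc, (hunit v).2, Matrix.mul_one]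

end SingularValues

/-! ### Squared Frobenius norm and unitary invariance -/

section FrobeniusSq

/-- The square of the Frobenius norm, as a sum over the entries. -/
noncomputable def frobSq {ι κ : Type*} [Fintype ι] [Fintype κ] (M : Matrix ι κ ℂ) : ℝ :=
  ∑ i, ∑ j, ‖M i j‖ ^ 2

variable {ι κ l : Type*} [Fintype ι] [Fintype κ] [Fintype l]

theorem frobSq_nonneg (M : Matrix ι κ ℂ) : 0 ≤ frobSq M := by
  unfold frobSq; positivity

theorem enorm_sq_eq_ofReal_frobSq (M : Matrix ι κ ℂ) : ‖M‖ₑ ^ 2 = ENNReal.ofReal (frobSq M) := by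
  have h0 := frobSq_nonneg M
  rw [← ofReal_norm, ← ENNReal.ofReal_pow (norm_nonneg _), frobenius_norm_def]
  congr 1
  simp only [Real.rpow_ofNat]
  rw [← Real.sqrt_eq_rpow]
  exact Real.sq_sqrt h0

theorem frobSq_conjTranspose (M : Matrix ι κ ℂ) : frobSq Mᴴ = frobSq M := by
  unfold frobSq
  rw [Finset.sum_comm]
  simp

theorem frobSq_neg (M : Matrix ι κ ℂ) : frobSq (-M) = frobSq M := by
  simp [frobSq]

theorem frobSq_eq_trace (M : Matrix ι κ ℂ) : (frobSq M : ℂ) = (Mᴴ * M).trace := by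
  simp only [frobSq, trace, diag, mul_apply, conjTranspose_apply]
  rw [Finset.sum_comm]
  push_cast
  refine Finset.sum_congr rfl fun i _ => Finset.sum_congr rfl fun j _ => ?_
  rw [← Complex.conj_mul', RCLike.star_def]

theorem frobSq_mul_left [DecidableEq ι] {U : Matrix l ι ℂ} (hU : Uᴴ * U = 1) (M : Matrix ι κ ℂ) :
    frobSq (U * M) = frobSq M := by
  have : (frobSq (U * M) : ℂ) = frobSq M := by
    rw [frobSq_eq_trace, frobSq_eq_trace, conjTranspose_mul, Matrix.mul_assoc,
      ← Matrix.mul_assoc Uᴴ, hU, Matrix.one_mul]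
  exact_mod_cast this

theorem frobSq_mul_right [DecidableEq κ] {U : Matrix κ l ℂ} (hU : U * Uᴴ = 1)
    (M : Matrix ι κ ℂ) : frobSq (M * U) = frobSq M := by
  rw [← frobSq_conjTranspose, conjTranspose_mul, frobSq_mul_left (by simpa using hU),
    frobSq_conjTranspose]

end FrobeniusSq

theorem IsUnitary.conjTranspose {ι κ : Type*} [Fintype ι] [Fintype κ] [DecidableEq ι]
    [DecidableEq κ] {U : Matrix ι κ ℂ} (h : IsUnitary U) : IsUnitary Uᴴ :=
  ⟨by simpa using h.2, by simpa using h.1⟩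

theorem IsUnitary.mul {ι κ l : Type*} [Fintype ι] [Fintype κ] [Fintype l] [DecidableEq ι]
    [DecidableEq κ] [DecidableEq l] {U : Matrix ι κ ℂ} {V : Matrix κ l ℂ} (hU : IsUnitary U)
    (hV : IsUnitary V) : IsUnitary (U * V) := by
  constructor
  · rw [conjTranspose_mul, Matrix.mul_assoc, ← Matrix.mul_assoc Uᴴ, hU.1, Matrix.one_mul, hV.1]
  · rw [conjTranspose_mul, Matrix.mul_assoc, ← Matrix.mul_assoc V, hV.2, Matrix.one_mul, hU.2]

theorem IsUnitary.sum_row {ι κ : Type*} [Fintype ι] [Fintype κ] [DecidableEq ι]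
    [DecidableEq κ] {U : Matrix ι κ ℂ} (h : IsUnitary U) (i : ι) : ∑ j, ‖U i j‖ ^ 2 = 1 := by
  have := congrFun (congrFun h.2 i) i
  simp only [mul_apply, conjTranspose_apply, one_apply_eq, RCLike.star_def, Complex.mul_conj'] at this
  exact_mod_cast this

theorem IsUnitary.sum_col {ι κ : Type*} [Fintype ι] [Fintype κ] [DecidableEq ι]
    [DecidableEq κ] {U : Matrix ι κ ℂ} (h : IsUnitary U) (j : κ) : ∑ i, ‖U i j‖ ^ 2 = 1 := by
  simpa using h.conjTranspose.sum_row j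

/-! ### Mirsky's inequality -/

section Mirsky

/-- By Birkhoff's theorem `M` is a convex combination of permutation matrices, and for each of these
the rearrangement inequality applies. -/
theorem sum_mul_doublyStochastic_le {n : ℕ} {d e : Fin n → ℝ} (hd : Antitone d) (he : Antitone e)
    {M : Matrix (Fin n) (Fin n) ℝ} (hM : M ∈ doublyStochastic ℝ (Fin n)) :
    ∑ i, ∑ j, d i * e j * M i j ≤ ∑ i, d i * e i := by
  obtain ⟨w, hw0, hw1, hwM⟩ := exists_eq_sum_perm_of_mem_doublyStochastic hM
  have hmono : Monovary d e := fun i j hij => hd (le_of_lt (he.reflect_lt hij))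
  have h1 : ∑ i, ∑ j, d i * e j * M i j = ∑ σ, w σ * ∑ i, d i * e (σ i) := by
    simp only [← hwM, Matrix.sum_apply, Matrix.smul_apply, smul_eq_mul, Finset.mul_sum]
    simp_rw [Finset.sum_comm (s := (Finset.univ : Finset (Fin n)))
      (t := (Finset.univ : Finset (Equiv.Perm (Fin n))))]
    refine Finset.sum_congr rfl fun σ _ => Finset.sum_congr rfl fun i _ => ?_
    rw [Finset.sum_eq_single (σ i)]
    · simp [Equiv.Perm.permMatrix, PEquiv.toMatrix_apply]; ring
    · intro j _ hj
      simp [Equiv.Perm.permMatrix, PEquiv.toMatrix_apply, hj.symm]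
    · simp
  rw [h1]
  calc ∑ σ, w σ * ∑ i, d i * e (σ i) ≤ ∑ σ, w σ * ∑ i, d i * e i :=
        Finset.sum_le_sum fun σ _ =>
          mul_le_mul_of_nonneg_left hmono.sum_mul_comp_perm_le_sum_mul (hw0 σ)
    _ = ∑ i, d i * e i := by rw [← Finset.sum_mul, hw1, one_mul]

/-- Expand the square and use `2 Re(x ȳ) ≤ |x|² + |y|²`; the sign of `d e` is what matters. -/
theorem normSq_sub_ge (d e : ℝ) (hd : 0 ≤ d) (he : 0 ≤ e) (x y : ℂ) :
    d ^ 2 * ‖y‖ ^ 2 + e ^ 2 * ‖x‖ ^ 2 - d * e * (‖x‖ ^ 2 + ‖y‖ ^ 2) ≤ ‖d * y - x * e‖ ^ 2 := by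
  have hde := mul_nonneg hd he
  simp only [← Complex.normSq_eq_norm_sq, Complex.normSq_apply, Complex.sub_re, Complex.sub_im,
    Complex.re_ofReal_mul, Complex.im_ofReal_mul, Complex.re_mul_ofReal, Complex.im_mul_ofReal]
  nlinarith [mul_nonneg hde (sq_nonneg (x.re - y.re)), mul_nonneg hde (sq_nonneg (x.im - y.im))]

/-- **Mirsky's inequality** for the Frobenius norm. -/
theorem sum_singularValue_sub_sq_le {n : ℕ} (A C : Matrix (Fin n) (Fin n) ℂ) :
    ∑ i, (singularValue A i - singularValue C i) ^ 2 ≤ frobSq (A - C) := by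
  obtain ⟨U, V, hU, hV, hA⟩ := exists_svd A
  obtain ⟨P, Q, hP, hQ, hC⟩ := exists_svd C
  set d := singularValue A with hd
  set e := singularValue C with he
  set X := Uᴴ * P with hX
  set Y := Vᴴ * Q with hY
  have hXu : IsUnitary X := hU.conjTranspose.mul hP
  have hYu : IsUnitary Y := hV.conjTranspose.mul hQ
  have hF : frobSq (A - C) = frobSq (diagonal (fun i => (d i : ℂ)) * Y -
      X * diagonal (fun i => (e i : ℂ))) := by
    rw [← frobSq_mul_left (U := Uᴴ) (by simpa using hU.2), ← frobSq_mul_right hQ.2]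
    congr 1
    rw [hX, hY, hA, hC]
    simp only [Matrix.mul_sub, Matrix.sub_mul, Matrix.mul_assoc]
    rw [hQ.1, ← Matrix.mul_assoc Uᴴ U, hU.1]
    simp
  -- The cross term involves entries of both `X` and `Y`; bounding it leaves the mean of two doubly
  -- stochastic matrices.
  have hM : (Matrix.of fun i j => (‖X i j‖ ^ 2 + ‖Y i j‖ ^ 2) / 2) ∈
      doublyStochastic ℝ (Fin n) := by
    rw [mem_doublyStochastic_iff_sum]
    refine ⟨fun i j => by simp only [of_apply]; positivity, fun i => ?_, fun j => ?_⟩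
    · simp only [of_apply]
      rw [← Finset.sum_div, Finset.sum_add_distrib, hXu.sum_row, hYu.sum_row]; norm_num
    · simp only [of_apply]
      rw [← Finset.sum_div, Finset.sum_add_distrib, hXu.sum_col, hYu.sum_col]; norm_num
  have hB := sum_mul_doublyStochastic_le (singularValue_antitone A) (singularValue_antitone C) hM
  rw [← hd, ← he] at hB
  simp only [of_apply] at hB
  have h1 : ∑ i, ∑ j, (d i ^ 2 * ‖Y i j‖ ^ 2 + e j ^ 2 * ‖X i j‖ ^ 2
      - d i * e j * (‖X i j‖ ^ 2 + ‖Y i j‖ ^ 2)) ≤ frobSq (A - C) := by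
    rw [hF, frobSq]
    refine Finset.sum_le_sum fun i _ => Finset.sum_le_sum fun j _ => ?_
    simpa [Matrix.sub_apply] using normSq_sub_ge (d i) (e j) (singularValue_nonneg _ _)
      (singularValue_nonneg _ _) (X i j) (Y i j)
  have h2 : ∑ i, ∑ j, d i ^ 2 * ‖Y i j‖ ^ 2 = ∑ i, d i ^ 2 := by
    simp [← Finset.mul_sum, hYu.sum_row]
  have h3 : ∑ i, ∑ j, e j ^ 2 * ‖X i j‖ ^ 2 = ∑ j, e j ^ 2 := by
    rw [Finset.sum_comm]
    simp [← Finset.mul_sum, hXu.sum_col]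
  have h4 : ∑ i, ∑ j, d i * e j * (‖X i j‖ ^ 2 + ‖Y i j‖ ^ 2) =
      2 * ∑ i, ∑ j, d i * e j * ((‖X i j‖ ^ 2 + ‖Y i j‖ ^ 2) / 2) := by
    simp only [Finset.mul_sum]
    exact Finset.sum_congr rfl fun i _ => Finset.sum_congr rfl fun j _ => by ring
  simp only [Finset.sum_add_distrib, Finset.sum_sub_distrib, h2, h3, h4] at h1
  have h5 : ∑ i, (d i - e i) ^ 2 = ∑ i, d i ^ 2 + ∑ i, e i ^ 2 - 2 * ∑ i, d i * e i := by
    rw [Finset.mul_sum, ← Finset.sum_add_distrib, ← Finset.sum_sub_distrib]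
    exact Finset.sum_congr rfl fun i _ => by ring
  linarith

end Mirsky

/-! ### Lower bounds for Sylvester operators -/

section Sylvester

/-- The two sides differ by exactly `2ab|x - y|²`. -/
theorem normSq_sylvester_ge (a b : ℝ) (ha : 0 ≤ a) (hb : 0 ≤ b) (x y : ℂ) :
    (a - b) ^ 2 * (‖x‖ ^ 2 + ‖y‖ ^ 2) ≤ ‖x * b - a * y‖ ^ 2 + ‖a * x - y * b‖ ^ 2 := by
  have hab := mul_nonneg ha hb
  simp only [← Complex.normSq_eq_norm_sq, Complex.normSq_apply, Complex.sub_re, Complex.sub_im,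
    Complex.re_ofReal_mul, Complex.im_ofReal_mul, Complex.re_mul_ofReal, Complex.im_mul_ofReal]
  nlinarith [mul_nonneg hab (sq_nonneg (x.re - y.re)), mul_nonneg hab (sq_nonneg (x.im - y.im))]

/-- The coupled Sylvester operator `(X, Y) ↦ (X T - S Y, Sᴴ X - Y Tᴴ)` is bounded below by the
distance between the singular values of `S` and `T`. -/
theorem frobSq_sylvester_ge {p q : ℕ} (S : Matrix (Fin p) (Fin p) ℂ)
    (T : Matrix (Fin q) (Fin q) ℂ) (X Y : Matrix (Fin p) (Fin q) ℂ) {g : ℝ} (hg : 0 ≤ g)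
    (h : ∀ a b, g ≤ |singularValue S a - singularValue T b|) :
    g ^ 2 * (frobSq X + frobSq Y) ≤ frobSq (X * T - S * Y) + frobSq (Sᴴ * X - Y * Tᴴ) := by
  obtain ⟨U, V, hU, hV, hS⟩ := exists_svd S
  obtain ⟨P, Q, hP, hQ, hT⟩ := exists_svd T
  set d := singularValue S with hd
  set e := singularValue T with he
  set D := diagonal (fun i => (d i : ℂ)) with hD
  set E := diagonal (fun i => (e i : ℂ)) with hE
  have hDs : Dᴴ = D := by
    rw [hD, diagonal_conjTranspose]; congr 1; ext i; simp
  have hEs : Eᴴ = E := by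
    rw [hE, diagonal_conjTranspose]; congr 1; ext i; simp
  set x := Uᴴ * X * P with hx
  set y := Vᴴ * Y * Q with hy
  have hxF : frobSq x = frobSq X := by
    rw [hx, frobSq_mul_right hP.2, frobSq_mul_left (by simpa using hU.2)]
  have hyF : frobSq y = frobSq Y := by
    rw [hy, frobSq_mul_right hQ.2, frobSq_mul_left (by simpa using hV.2)]
  have h1 : frobSq (X * T - S * Y) = frobSq (x * E - D * y) := by
    rw [← frobSq_mul_left (U := Uᴴ) (by simpa using hU.2), ← frobSq_mul_right hQ.2]
    congr 1
    rw [hx, hy, hS, hT]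
    simp only [Matrix.mul_sub, Matrix.sub_mul, Matrix.mul_assoc]
    rw [hQ.1, ← Matrix.mul_assoc Uᴴ U, hU.1]
    simp
  -- The outer factors are `Vᴴ` and `P` here, against `Uᴴ` and `Q` in `h1`, so that the same `x` and
  -- `y` appear and both equations become diagonal together.
  have h2 : frobSq (Sᴴ * X - Y * Tᴴ) = frobSq (D * x - y * E) := by
    rw [← frobSq_mul_left (U := Vᴴ) (by simpa using hV.2), ← frobSq_mul_right hP.2]
    congr 1
    rw [hx, hy, hS, hT]
    simp only [conjTranspose_mul, conjTranspose_conjTranspose, hDs, hEs, Matrix.mul_sub,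
      Matrix.sub_mul, Matrix.mul_assoc]
    rw [hP.1, ← Matrix.mul_assoc Vᴴ V, hV.1]
    simp
  rw [← hxF, ← hyF, h1, h2]
  simp only [frobSq, ← Finset.sum_add_distrib, Finset.mul_sum]
  refine Finset.sum_le_sum fun i _ => Finset.sum_le_sum fun j _ => ?_
  have hgd : g ^ 2 ≤ (d i - e j) ^ 2 := by
    rw [← sq_abs (d i - e j)]
    exact pow_le_pow_left₀ hg (h i j) 2
  refine (mul_le_mul_of_nonneg_right hgd (by positivity)).trans ?_
  simpa [hD, hE, Matrix.sub_apply] using normSq_sylvester_ge (d i) (e j)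
    (singularValue_nonneg _ _) (singularValue_nonneg _ _) (x i j) (y i j)

theorem frobSq_mul_ge {p q : ℕ} (S : Matrix (Fin q) (Fin q) ℂ) (X : Matrix (Fin p) (Fin q) ℂ)
    {g : ℝ} (hg : 0 ≤ g) (h : ∀ a, g ≤ singularValue S a) :
    g ^ 2 * frobSq X ≤ frobSq (X * S) := by
  obtain ⟨P, Q, hP, hQ, hS⟩ := exists_svd S
  have h1 : frobSq (X * S) = frobSq (X * P * diagonal fun i => (singularValue S i : ℂ)) := by
    rw [← frobSq_mul_right hQ.2]
    conv_lhs => rw [hS]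
    simp only [Matrix.mul_assoc]
    rw [hQ.1, Matrix.mul_one]
  rw [h1, ← frobSq_mul_right hP.2 X]
  simp only [frobSq, Finset.mul_sum]
  refine Finset.sum_le_sum fun i _ => Finset.sum_le_sum fun j _ => ?_
  rw [mul_diagonal, norm_mul, mul_pow, mul_comm]
  simp only [Complex.norm_real, Real.norm_eq_abs, sq_abs]
  exact mul_le_mul_of_nonneg_left (pow_le_pow_left₀ hg (h j) 2) (by positivity)

end Sylvester

/-! ### Entrywise derivatives of matrix functions -/

section Derivative

variable {ι κ l : Type*}

theorem matDeriv_mul [Fintype κ] {F : ℝ → Matrix ι κ ℂ} {G : ℝ → Matrix κ l ℂ} (hF : IsAnalytic F)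
    (hG : IsAnalytic G) (t : ℝ) :
    matDeriv (fun s => F s * G s) t = matDeriv F t * G t + F t * matDeriv G t := by
  ext a b
  simp only [matDeriv, of_apply, Matrix.add_apply, mul_apply]
  have h : ∀ c ∈ (Finset.univ : Finset κ), HasDerivAt (fun s => F s a c * G s c b)
      (deriv (fun s => F s a c) t * G t c b + F t a c * deriv (fun s => G s c b) t) t :=
    fun c _ => (hF a c t).differentiableAt.hasDerivAt.mul (hG c b t).differentiableAt.hasDerivAt
  rw [(HasDerivAt.fun_sum h).deriv, Finset.sum_add_distrib]

theorem IsAnalytic.conjTranspose {F : ℝ → Matrix ι κ ℂ} (hF : IsAnalytic F) :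
    IsAnalytic fun s => (F s)ᴴ := fun a b t =>
  ((Complex.conjCLE : ℂ →L[ℝ] ℂ).analyticAt (F t b a)).comp (f := fun s => F s b a) (hF b a t)

theorem matDeriv_conjTranspose {F : ℝ → Matrix ι κ ℂ} (hF : IsAnalytic F) (t : ℝ) :
    matDeriv (fun s => (F s)ᴴ) t = (matDeriv F t)ᴴ := by
  ext a b
  exact ((hF b a t).differentiableAt.hasDerivAt.star).deriv

theorem matDeriv_const (M : Matrix ι κ ℂ) (t : ℝ) : matDeriv (fun _ => M) t = 0 := by
  ext a b
  simp [matDeriv]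

theorem isAnalytic_add_smul (B D : Matrix ι κ ℂ) : IsAnalytic fun t : ℝ => B + t • D := by
  intro a b t
  simp only [Matrix.add_apply, Matrix.smul_apply]
  fun_prop

theorem matDeriv_add_smul (B D : Matrix ι κ ℂ) (t : ℝ) :
    matDeriv (fun t : ℝ => B + t • D) t = D := by
  ext a b
  have : HasDerivAt (fun s : ℝ => B a b + s • D a b) (0 + (1 : ℝ) • D a b) t :=
    (hasDerivAt_const t (B a b)).add ((hasDerivAt_id t).smul_const (D a b))
  simpa [matDeriv] using this.deriv

/-- If `F(t)ᴴ G(t)` is constant then `Fᴴ G' = -(Gᴴ F')ᴴ`. -/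
theorem conjTranspose_mul_matDeriv [Fintype ι] {F : ℝ → Matrix ι κ ℂ} {G : ℝ → Matrix ι l ℂ}
    (hF : IsAnalytic F) (hG : IsAnalytic G) {M : Matrix κ l ℂ}
    (h : ∀ s, (F s)ᴴ * G s = M) (t : ℝ) :
    (F t)ᴴ * matDeriv G t = -((G t)ᴴ * matDeriv F t)ᴴ := by
  have h1 := matDeriv_mul hF.conjTranspose hG t
  simp only [h] at h1
  rw [matDeriv_const, matDeriv_conjTranspose hF] at h1
  rw [conjTranspose_mul, conjTranspose_conjTranspose]
  exact eq_neg_of_add_eq_zero_right h1.symm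

end Derivative

/-! ### Orthogonality relations and norm splitting for block columns -/

section Blocks

variable {d k e : ℕ} {r : Fin k → ℕ} {M : (j : Fin k) → Matrix (Fin d) (Fin (r j)) ℂ}
  {N : Matrix (Fin d) (Fin e) ℂ}

theorem blockRow_gram_of_ne (h : (blockRow M)ᴴ * blockRow M = 1) {i j : Fin k} (hij : j ≠ i) :
    (M j)ᴴ * M i = 0 := by
  ext a b
  have := congrFun (congrFun h ⟨j, a⟩) ⟨i, b⟩
  rw [one_apply_ne (by simp [hij])] at this
  exact this

theorem blockRow_gram_self (h : (blockRow M)ᴴ * blockRow M = 1) (j : Fin k) :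
    (M j)ᴴ * M j = 1 := by
  ext a b
  have := congrFun (congrFun h ⟨j, a⟩) ⟨j, b⟩
  simp only [one_apply, Sigma.mk.injEq, heq_eq_eq, true_and] at this ⊢
  exact this

theorem IsUnitary.gram_left (h : IsUnitary (fromCols (blockRow M) N)) :
    (blockRow M)ᴴ * blockRow M = 1 := by
  ext a b
  have := congrFun (congrFun h.1 (Sum.inl a)) (Sum.inl b)
  simp only [one_apply, Sum.inl.injEq] at this ⊢
  exact this

theorem IsUnitary.last_gram (h : IsUnitary (fromCols (blockRow M) N)) (j : Fin k) :
    Nᴴ * M j = 0 := by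
  ext a b
  have := congrFun (congrFun h.1 (Sum.inr a)) (Sum.inl ⟨j, b⟩)
  rw [one_apply_ne (by simp)] at this
  exact this

variable {κ : Type*} [Fintype κ]

theorem IsUnitary.frobSq_eq_sum_add (h : IsUnitary (fromCols (blockRow M) N))
    (A : Matrix (Fin d) κ ℂ) :
    frobSq A = ∑ j, frobSq ((M j)ᴴ * A) + frobSq (Nᴴ * A) := by
  rw [← frobSq_mul_left (U := (fromCols (blockRow M) N)ᴴ) (by simpa using h.2)]
  simp only [frobSq, Fintype.sum_sum_type, Fintype.sum_sigma]
  rfl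

theorem IsUnitary.frobSq_eq_sum_left (h : IsUnitary (blockRow M)) (A : Matrix (Fin d) κ ℂ) :
    frobSq A = ∑ j, frobSq ((M j)ᴴ * A) := by
  rw [← frobSq_mul_left (U := (blockRow M)ᴴ) (by simpa using h.2)]
  simp only [frobSq, Fintype.sum_sigma]
  rfl

theorem IsUnitary.frobSq_eq_sum_right (h : IsUnitary (blockRow M)) (A : Matrix κ (Fin d) ℂ) :
    frobSq A = ∑ j, frobSq (A * M j) := by
  rw [← frobSq_conjTranspose, h.frobSq_eq_sum_left]
  refine Finset.sum_congr rfl fun j _ => ?_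
  rw [← frobSq_conjTranspose, conjTranspose_mul, conjTranspose_conjTranspose,
    conjTranspose_conjTranspose]

end Blocks

/-! ### Blocks of `ΔB` and the infinitesimal bound -/

namespace IsAnalyticFactorization

variable {m n k : ℕ} {r : Fin k → ℕ} {B ΔB : Matrix (Fin m) (Fin n) ℂ}
  {W : (j : Fin k) → ℝ → Matrix (Fin m) (Fin (r j)) ℂ}
  {Wlast : ℝ → Matrix (Fin m) (Fin (m - n)) ℂ}
  {S : (j : Fin k) → ℝ → Matrix (Fin (r j)) (Fin (r j)) ℂ}
  {V : (j : Fin k) → ℝ → Matrix (Fin n) (Fin (r j)) ℂ}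

theorem mul_blockRow (h : IsAnalyticFactorization B ΔB W Wlast S V) (t : ℝ) :
    (B + t • ΔB) * blockRow (fun j => V j t) =
      blockRow (fun j => W j t) * blockDiagonal' fun j => S j t := by
  rw [h.factorization, Matrix.mul_assoc, (h.unitary_V t).1, Matrix.mul_one, fromCols_mul_fromRows,
    Matrix.mul_zero, add_zero]

theorem mul_V (h : IsAnalyticFactorization B ΔB W Wlast S V) (i : Fin k) (t : ℝ) :
    (B + t • ΔB) * V i t = W i t * S i t := by
  ext a b
  have h1 := congrFun (congrFun (h.mul_blockRow t) a) ⟨i, b⟩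
  have h2 : (blockRow (fun j => W j t) * blockDiagonal' fun j => S j t) a ⟨i, b⟩ =
      (W i t * S i t) a b := by
    simp only [mul_apply, Fintype.sum_sigma]
    rw [Finset.sum_eq_single i]
    · simp [blockRow]
    · intro j _ hj
      exact Finset.sum_eq_zero fun c _ => by rw [blockDiagonal'_apply_ne _ _ _ hj, mul_zero]
    · simp
  rw [← h2, ← h1]
  rfl

/-- It suffices to test against the unitary `V(t)`, where `mul_V` and orthogonality of the blocks
give both sides. -/
theorem W_mul (h : IsAnalyticFactorization B ΔB W Wlast S V) (j : Fin k) (t : ℝ) :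
    (W j t)ᴴ * (B + t • ΔB) = S j t * (V j t)ᴴ := by
  have hW := (h.unitary_W t).gram_left
  have hV := (h.unitary_V t).1
  have key : (W j t)ᴴ * (B + t • ΔB) * blockRow (fun j => V j t) =
      S j t * (V j t)ᴴ * blockRow (fun j => V j t) := by
    ext a ⟨i, b⟩
    change ((W j t)ᴴ * (B + t • ΔB) * V i t) a b = (S j t * (V j t)ᴴ * V i t) a b
    rw [Matrix.mul_assoc, h.mul_V, ← Matrix.mul_assoc, Matrix.mul_assoc (S j t)]
    by_cases hij : j = i
    · subst hij
      rw [blockRow_gram_self hW, blockRow_gram_self hV, Matrix.one_mul, Matrix.mul_one]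
    · rw [blockRow_gram_of_ne hW hij, blockRow_gram_of_ne hV hij, Matrix.zero_mul, Matrix.mul_zero]
  have := congrArg (· * (blockRow (fun j => V j t))ᴴ) key
  simpa only [Matrix.mul_assoc, (h.unitary_V t).2, Matrix.mul_one] using this

theorem Wlast_mul (h : IsAnalyticFactorization B ΔB W Wlast S V) (t : ℝ) :
    (Wlast t)ᴴ * (B + t • ΔB) = 0 := by
  have key : (Wlast t)ᴴ * (B + t • ΔB) * blockRow (fun j => V j t) = 0 := by
    ext a ⟨i, b⟩
    change ((Wlast t)ᴴ * (B + t • ΔB) * V i t) a b = 0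
    rw [Matrix.mul_assoc, h.mul_V, ← Matrix.mul_assoc, (h.unitary_W t).last_gram, Matrix.zero_mul,
      Matrix.zero_apply]
  have := congrArg (· * (blockRow (fun j => V j t))ᴴ) key
  simpa only [Matrix.mul_assoc, (h.unitary_V t).2, Matrix.mul_one, Matrix.zero_mul] using this

theorem deriv_mul_V (h : IsAnalyticFactorization B ΔB W Wlast S V) (i : Fin k) (t : ℝ) :
    ΔB * V i t + (B + t • ΔB) * matDeriv (V i) t =
      matDeriv (W i) t * S i t + W i t * matDeriv (S i) t := by
  have h1 := matDeriv_mul (isAnalytic_add_smul B ΔB) (h.analytic_V i) t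
  have h2 := matDeriv_mul (h.analytic_W i) (h.analytic_S i) t
  rw [matDeriv_add_smul] at h1
  rw [← h1, ← h2]
  exact congrArg (matDeriv · t) (funext fun s => h.mul_V i s)

theorem W_mul_delta_mul_V_self (h : IsAnalyticFactorization B ΔB W Wlast S V) (i : Fin k) (t : ℝ) :
    (W i t)ᴴ * (ΔB * V i t) = matDeriv (S i) t := by
  rw [eq_sub_of_add_eq (h.deriv_mul_V i t), Matrix.mul_sub, Matrix.mul_add, ← Matrix.mul_assoc,
    ← Matrix.mul_assoc, ← Matrix.mul_assoc, h.W_mul, h.orth_W,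
    Matrix.mul_assoc (S i t), h.orth_V, blockRow_gram_self (h.unitary_W t).gram_left]
  simp

theorem W_mul_delta_mul_V_of_ne (h : IsAnalyticFactorization B ΔB W Wlast S V) {j i : Fin k}
    (hij : j ≠ i) (t : ℝ) :
    (W j t)ᴴ * (ΔB * V i t) =
      (W j t)ᴴ * matDeriv (W i) t * S i t - S j t * ((V j t)ᴴ * matDeriv (V i) t) := by
  rw [eq_sub_of_add_eq (h.deriv_mul_V i t), Matrix.mul_sub, Matrix.mul_add, ← Matrix.mul_assoc,
    ← Matrix.mul_assoc, ← Matrix.mul_assoc, h.W_mul,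
    blockRow_gram_of_ne (h.unitary_W t).gram_left hij, Matrix.mul_assoc (S j t)]
  simp

theorem Wlast_mul_delta_mul_V (h : IsAnalyticFactorization B ΔB W Wlast S V) (i : Fin k) (t : ℝ) :
    (Wlast t)ᴴ * (ΔB * V i t) = (Wlast t)ᴴ * matDeriv (W i) t * S i t := by
  rw [eq_sub_of_add_eq (h.deriv_mul_V i t), Matrix.mul_sub, Matrix.mul_add, ← Matrix.mul_assoc,
    ← Matrix.mul_assoc, ← Matrix.mul_assoc, h.Wlast_mul, (h.unitary_W t).last_gram]
  simp

theorem W_mul_deriv_W (h : IsAnalyticFactorization B ΔB W Wlast S V) {j i : Fin k}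
    (hij : j ≠ i) (t : ℝ) :
    (W j t)ᴴ * matDeriv (W i) t = -((W i t)ᴴ * matDeriv (W j) t)ᴴ :=
  conjTranspose_mul_matDeriv (h.analytic_W j) (h.analytic_W i)
    (fun s => blockRow_gram_of_ne (h.unitary_W s).gram_left hij) t

theorem V_mul_deriv_V (h : IsAnalyticFactorization B ΔB W Wlast S V) {j i : Fin k}
    (hij : j ≠ i) (t : ℝ) :
    (V j t)ᴴ * matDeriv (V i) t = -((V i t)ᴴ * matDeriv (V j) t)ᴴ :=
  conjTranspose_mul_matDeriv (h.analytic_V j) (h.analytic_V i)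
    (fun s => blockRow_gram_of_ne (h.unitary_V s).1 hij) t

theorem frobSq_Wlast_mul_deriv_W (h : IsAnalyticFactorization B ΔB W Wlast S V) (j : Fin k)
    (t : ℝ) :
    frobSq ((W j t)ᴴ * matDeriv Wlast t) = frobSq ((Wlast t)ᴴ * matDeriv (W j) t) := by
  rw [conjTranspose_mul_matDeriv h.analytic_Wlast (h.analytic_W j)
    (fun s => (h.unitary_W s).last_gram j) t, frobSq_neg, frobSq_conjTranspose]

theorem frobSq_delta (h : IsAnalyticFactorization B ΔB W Wlast S V) (t : ℝ) :
    frobSq ΔB = ∑ i, (∑ j, frobSq ((W j t)ᴴ * (ΔB * V i t)) +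
      frobSq ((Wlast t)ᴴ * (ΔB * V i t))) := by
  rw [(h.unitary_V t).frobSq_eq_sum_right]
  exact Finset.sum_congr rfl fun i _ => (h.unitary_W t).frobSq_eq_sum_add _

/-- The contribution of a pair of distinct blocks. -/
theorem offDiag_ge (h : IsAnalyticFactorization B ΔB W Wlast S V) {j i : Fin k}
    (hij : j ≠ i) (t : ℝ) {g : ℝ} (hg : 0 ≤ g)
    (hgap : ∀ a b, g ≤ |singularValue (S j t) a - singularValue (S i t) b|) :
    g ^ 2 * (frobSq ((W j t)ᴴ * matDeriv (W i) t) + frobSq ((V j t)ᴴ * matDeriv (V i) t)) ≤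
      frobSq ((W j t)ᴴ * (ΔB * V i t)) + frobSq ((W i t)ᴴ * (ΔB * V j t)) := by
  have h1 := frobSq_sylvester_ge (S j t) (S i t) ((W j t)ᴴ * matDeriv (W i) t)
    ((V j t)ᴴ * matDeriv (V i) t) hg hgap
  rw [h.W_mul_delta_mul_V_of_ne hij, h.W_mul_delta_mul_V_of_ne hij.symm,
    h.W_mul_deriv_W hij.symm, h.V_mul_deriv_V hij.symm]
  refine h1.trans_eq ?_
  congr 1
  -- By skewness, block `(i, j)` is minus the adjoint of the second Sylvester component of block
  -- `(j, i)`.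
  rw [← frobSq_conjTranspose, ← frobSq_neg]
  congr 1
  simp only [conjTranspose_sub, conjTranspose_mul, conjTranspose_conjTranspose,
    Matrix.neg_mul, Matrix.mul_neg]
  abel

/-- The infinitesimal form of the bound. -/
theorem frobSq_deriv_le (h : IsAnalyticFactorization B ΔB W Wlast S V) (t : ℝ) {p q : Fin k → ℝ}
    {s : ℝ} (hp0 : ∀ j, 0 ≤ p j) (hq0 : ∀ j, 0 ≤ q j) (hs0 : 0 ≤ s)
    (hp : ∀ j i, i ≠ j → ∀ a b, p j ≤ |singularValue (S j t) a - singularValue (S i t) b|)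
    (hq : ∀ j i, i ≠ j → ∀ a b, q j ≤ |singularValue (S j t) a - singularValue (S i t) b|)
    (hq' : m - n = 0 ∨ ∀ j a, q j ≤ singularValue (S j t) a)
    (hs : ∀ j a, s ≤ singularValue (S j t) a) :
    ∑ j, frobSq (matDeriv (S j) t) + ∑ j, q j ^ 2 / 2 * frobSq (matDeriv (W j) t)
      + s ^ 2 / 2 * frobSq (matDeriv Wlast t)
      + ∑ j, p j ^ 2 / 2 * frobSq (matDeriv (V j) t) ≤ frobSq ΔB := by
  have hx0 : ∀ i, frobSq ((W i t)ᴴ * matDeriv (W i) t) = 0 := fun i => by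
    rw [h.orth_W]; simp [frobSq]
  have hy0 : ∀ i, frobSq ((V i t)ᴴ * matDeriv (V i) t) = 0 := fun i => by
    rw [h.orth_V]; simp [frobSq]
  -- The components of `Ẇ_{k+1}` are, up to sign and adjoint, the `W_{k+1}ᴴ Ẇ_j`, so the last row of
  -- `ΔB` controls them too.
  have hlast : frobSq (matDeriv Wlast t) = ∑ j, frobSq ((Wlast t)ᴴ * matDeriv (W j) t) := by
    rw [(h.unitary_W t).frobSq_eq_sum_add, h.orth_Wlast]
    simp only [h.frobSq_Wlast_mul_deriv_W]
    simp [frobSq]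
  have hWd := fun i => (h.unitary_W t).frobSq_eq_sum_add (matDeriv (W i) t)
  have hVd := fun i => (h.unitary_V t).frobSq_eq_sum_left (matDeriv (V i) t)
  have hz : ∀ i, q i ^ 2 * frobSq ((Wlast t)ᴴ * matDeriv (W i) t) ≤
      frobSq ((Wlast t)ᴴ * (ΔB * V i t)) := by
    intro i
    rw [h.Wlast_mul_delta_mul_V]
    rcases hq' with h0 | hq'
    · have : IsEmpty (Fin (m - n)) := by rw [h0]; infer_instance
      -- When `m - n = 0` the last block row is empty, and no singular value bound on `q` is needed.
      simp [frobSq]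
    · exact frobSq_mul_ge _ _ (hq0 i) (hq' i)
  have hzs : ∀ i, s ^ 2 * frobSq ((Wlast t)ᴴ * matDeriv (W i) t) ≤
      frobSq ((Wlast t)ᴴ * (ΔB * V i t)) := by
    intro i
    rw [h.Wlast_mul_delta_mul_V]
    exact frobSq_mul_ge _ _ hs0 (hs i)
  -- The subtracted term makes the case `j = i` an equality `0 = 0`, so the sum can run over all
  -- pairs while `Ṡ_i` is kept aside.
  have hoff : ∀ i j, q i ^ 2 * frobSq ((W j t)ᴴ * matDeriv (W i) t)
      + p i ^ 2 * frobSq ((V j t)ᴴ * matDeriv (V i) t) ≤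
      frobSq ((W j t)ᴴ * (ΔB * V i t)) + frobSq ((W i t)ᴴ * (ΔB * V j t))
        - if j = i then 2 * frobSq (matDeriv (S i) t) else 0 := by
    intro i j
    split_ifs with hij
    · subst hij
      rw [hx0, hy0, h.W_mul_delta_mul_V_self]
      apply le_of_eq; ring
    -- Both weights lie below the same gap, so one application with their maximum covers both.
    · have hmax := h.offDiag_ge hij t ((hp0 i).trans (le_max_left (p i) (q i))) (fun a b => by
        rw [abs_sub_comm]
        exact max_le (hp i j hij b a) (hq i j hij b a))
      have h1 : q i ^ 2 ≤ (max (p i) (q i)) ^ 2 := pow_le_pow_left₀ (hq0 i) (le_max_right _ _) 2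
      have h2 : p i ^ 2 ≤ (max (p i) (q i)) ^ 2 := pow_le_pow_left₀ (hp0 i) (le_max_left _ _) 2
      have h3 := mul_le_mul_of_nonneg_right h1 (frobSq_nonneg ((W j t)ᴴ * matDeriv (W i) t))
      have h4 := mul_le_mul_of_nonneg_right h2 (frobSq_nonneg ((V j t)ᴴ * matDeriv (V i) t))
      linarith
  have hsum := Finset.sum_le_sum fun i (_ : i ∈ Finset.univ) =>
    Finset.sum_le_sum fun j (_ : j ∈ Finset.univ) => hoff i j
  simp only [Finset.sum_add_distrib, Finset.sum_sub_distrib, ← Finset.mul_sum,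
    Finset.sum_ite_eq', Finset.mem_univ, if_true] at hsum
  rw [Finset.sum_comm (f := fun i j => frobSq ((W i t)ᴴ * (ΔB * V j t)))] at hsum
  have hzsum := Finset.sum_le_sum fun i (_ : i ∈ Finset.univ) => hz i
  have hzssum := Finset.sum_le_sum fun i (_ : i ∈ Finset.univ) => hzs i
  rw [← Finset.mul_sum] at hzssum
  rw [h.frobSq_delta t, hlast]
  simp only [hWd, hVd, Finset.sum_add_distrib, mul_add, div_mul_eq_mul_div, ← Finset.sum_div]
  -- Half of `hsum`, half of `hzsum` and half of `hzssum` add up to the claim.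
  linarith

end IsAnalyticFactorization

/-! ### From derivatives to increments -/

section Integration

open intervalIntegral

theorem norm_sub_sq_le_integral {f : ℝ → ℂ} (hf : ∀ t, AnalyticAt ℝ f t) :
    ‖f 1 - f 0‖ ^ 2 ≤ ∫ t in (0 : ℝ)..1, ‖deriv f t‖ ^ 2 := by
  have hc : Continuous (deriv f) :=
    continuous_iff_continuousAt.2 fun t => (hf t).deriv.continuousAt
  have h1 : ∫ t in (0 : ℝ)..1, deriv f t = f 1 - f 0 :=
    integral_eq_sub_of_hasDerivAt (fun t _ => (hf t).differentiableAt.hasDerivAt)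
      (hc.intervalIntegrable _ _)
  set c := ∫ t in (0 : ℝ)..1, ‖deriv f t‖ with hcdef
  have h2 : ‖f 1 - f 0‖ ≤ c := by
    rw [← h1]
    exact norm_integral_le_integral_norm zero_le_one
  -- Cauchy-Schwarz: integrate `(‖f'‖ - c)² ≥ 0`, with `c` the mean of `‖f'‖` on `[0, 1]`.
  have h3 : 0 ≤ ∫ t in (0 : ℝ)..1, (‖deriv f t‖ ^ 2 - 2 * c * ‖deriv f t‖ + c ^ 2) :=
    integral_nonneg zero_le_one fun t _ => by nlinarith [sq_nonneg (‖deriv f t‖ - c)]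
  rw [integral_add (Continuous.intervalIntegrable (by fun_prop) _ _)
      (Continuous.intervalIntegrable (by fun_prop) _ _),
    integral_sub (Continuous.intervalIntegrable (by fun_prop) _ _)
      (Continuous.intervalIntegrable (by fun_prop) _ _),
    integral_const_mul, ← hcdef, integral_const] at h3
  have h4 : ‖f 1 - f 0‖ ^ 2 ≤ c ^ 2 := pow_le_pow_left₀ (norm_nonneg _) h2 2
  simp only [sub_zero, one_smul] at h3
  nlinarith

variable {ι κ : Type*} [Fintype ι] [Fintype κ]

theorem IsAnalytic.continuous_frobSq_matDeriv {F : ℝ → Matrix ι κ ℂ} (hF : IsAnalytic F) :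
    Continuous fun t => frobSq (matDeriv F t) := by
  have hc : ∀ a b, Continuous (deriv fun s => F s a b) := fun a b =>
    continuous_iff_continuousAt.2 fun t => (hF a b t).deriv.continuousAt
  simp only [frobSq, matDeriv, of_apply]
  exact continuous_finsetSum _ fun a _ => continuous_finsetSum _ fun b _ => (hc a b).norm.pow 2

theorem IsAnalytic.frobSq_sub_le_integral {F : ℝ → Matrix ι κ ℂ} (hF : IsAnalytic F) :
    frobSq (F 1 - F 0) ≤ ∫ t in (0 : ℝ)..1, frobSq (matDeriv F t) := by
  have hc : ∀ a b, Continuous (deriv fun s => F s a b) := fun a b =>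
    continuous_iff_continuousAt.2 fun t => (hF a b t).deriv.continuousAt
  simp only [frobSq, matDeriv, of_apply]
  have h1 : ∀ a b, IntervalIntegrable (fun t => ‖deriv (fun s => F s a b) t‖ ^ 2)
      MeasureTheory.volume 0 1 := fun a b => ((hc a b).norm.pow 2).intervalIntegrable _ _
  have h2 : ∀ a, IntervalIntegrable (fun t => ∑ b, ‖deriv (fun s => F s a b) t‖ ^ 2)
      MeasureTheory.volume 0 1 := fun a =>
    (continuous_finsetSum _ fun b _ => (hc a b).norm.pow 2).intervalIntegrable _ _
  rw [integral_finsetSum fun a _ => h2 a]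
  refine Finset.sum_le_sum fun a _ => ?_
  rw [integral_finsetSum fun b _ => h1 a b]
  exact Finset.sum_le_sum fun b _ => norm_sub_sq_le_integral (hF a b)

end Integration

theorem frobSq_submatrix_equiv {ι κ ι' κ' : Type*} [Fintype ι] [Fintype κ] [Fintype ι']
    [Fintype κ'] (M : Matrix ι κ ℂ) (e : ι' ≃ ι) (f : κ' ≃ κ) :
    frobSq (M.submatrix e f) = frobSq M := by
  simp only [frobSq, submatrix_apply]
  rw [e.sum_comp fun x => ∑ y, ‖M x (f y)‖ ^ 2]
  exact Finset.sum_congr rfl fun x _ => f.sum_comp fun y => ‖M x y‖ ^ 2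

theorem frobSq_blockDiagonal {k : ℕ} {r : Fin k → ℕ}
    (D : (j : Fin k) → Matrix (Fin (r j)) (Fin (r j)) ℂ) :
    frobSq (blockDiagonal' D) = ∑ j, frobSq (D j) := by
  simp only [frobSq, Fintype.sum_sigma]
  refine Finset.sum_congr rfl fun j _ => Finset.sum_congr rfl fun a _ => ?_
  rw [Finset.sum_eq_single j]
  · simp
  · intro i _ hi
    exact Finset.sum_eq_zero fun c _ => by rw [blockDiagonal'_apply_ne _ _ _ hi.symm]; simp
  · simp

/-! ### The integrated bound with finite weights -/

namespace IsAnalyticFactorization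

variable {m n k : ℕ} {r : Fin k → ℕ} {B ΔB : Matrix (Fin m) (Fin n) ℂ}
  {W : (j : Fin k) → ℝ → Matrix (Fin m) (Fin (r j)) ℂ}
  {Wlast : ℝ → Matrix (Fin m) (Fin (m - n)) ℂ}
  {S : (j : Fin k) → ℝ → Matrix (Fin (r j)) (Fin (r j)) ℂ}
  {V : (j : Fin k) → ℝ → Matrix (Fin n) (Fin (r j)) ℂ}

theorem frobSq_blocks_sub_le (h : IsAnalyticFactorization B ΔB W Wlast S V)
    {p q : Fin k → ℝ} {s : ℝ} (hp0 : ∀ j, 0 ≤ p j) (hq0 : ∀ j, 0 ≤ q j) (hs0 : 0 ≤ s)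
    (hp : ∀ t ∈ Set.Icc (0 : ℝ) 1, ∀ j i, i ≠ j → ∀ a b,
      p j ≤ |singularValue (S j t) a - singularValue (S i t) b|)
    (hq : ∀ t ∈ Set.Icc (0 : ℝ) 1, ∀ j i, i ≠ j → ∀ a b,
      q j ≤ |singularValue (S j t) a - singularValue (S i t) b|)
    (hq' : m - n = 0 ∨ ∀ t ∈ Set.Icc (0 : ℝ) 1, ∀ j a, q j ≤ singularValue (S j t) a)
    (hs : ∀ t ∈ Set.Icc (0 : ℝ) 1, ∀ j a, s ≤ singularValue (S j t) a) :
    ∑ j, frobSq (S j 1 - S j 0) + ∑ j, q j ^ 2 / 2 * frobSq (W j 1 - W j 0)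
      + s ^ 2 / 2 * frobSq (Wlast 1 - Wlast 0)
      + ∑ j, p j ^ 2 / 2 * frobSq (V j 1 - V j 0) ≤ frobSq ΔB := by
  have cS := fun j => (h.analytic_S j).continuous_frobSq_matDeriv
  have cW := fun j => (h.analytic_W j).continuous_frobSq_matDeriv
  have cV := fun j => (h.analytic_V j).continuous_frobSq_matDeriv
  have cL := h.analytic_Wlast.continuous_frobSq_matDeriv
  have hint : ∫ t in (0 : ℝ)..1, (∑ j, frobSq (matDeriv (S j) t)
      + ∑ j, q j ^ 2 / 2 * frobSq (matDeriv (W j) t)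
      + s ^ 2 / 2 * frobSq (matDeriv Wlast t)
      + ∑ j, p j ^ 2 / 2 * frobSq (matDeriv (V j) t)) ≤ ∫ _ in (0 : ℝ)..1, frobSq ΔB := by
    refine intervalIntegral.integral_mono_on zero_le_one
      (Continuous.intervalIntegrable (by fun_prop) _ _)
      (Continuous.intervalIntegrable (by fun_prop) _ _) fun t ht => ?_
    exact h.frobSq_deriv_le t hp0 hq0 hs0 (hp t ht) (hq t ht) (hq'.imp id fun H => H t ht) (hs t ht)
  rw [intervalIntegral.integral_add (Continuous.intervalIntegrable (by fun_prop) _ _)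
      (Continuous.intervalIntegrable (by fun_prop) _ _),
    intervalIntegral.integral_add (Continuous.intervalIntegrable (by fun_prop) _ _)
      (Continuous.intervalIntegrable (by fun_prop) _ _),
    intervalIntegral.integral_add (Continuous.intervalIntegrable (by fun_prop) _ _)
      (Continuous.intervalIntegrable (by fun_prop) _ _),
    intervalIntegral.integral_finsetSum
      (fun j _ => Continuous.intervalIntegrable (by fun_prop) _ _),
    intervalIntegral.integral_finsetSum
      (fun j _ => Continuous.intervalIntegrable (by fun_prop) _ _),
    intervalIntegral.integral_finsetSum
      (fun j _ => Continuous.intervalIntegrable (by fun_prop) _ _)] at hint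
  simp only [intervalIntegral.integral_const_mul, intervalIntegral.integral_const, sub_zero,
    one_smul] at hint
  refine le_trans ?_ hint
  gcongr with j _ j _ j _
  · exact (h.analytic_S j).frobSq_sub_le_integral
  · exact (h.analytic_W j).frobSq_sub_le_integral
  · exact h.analytic_Wlast.frobSq_sub_le_integral
  · exact (h.analytic_V j).frobSq_sub_le_integral

/-- The Gram matrix of `B + t ΔB` is `V Dᴴ D Vᴴ` with `D = diag(S_j)`. Moving the unitary factor
around by `charpoly_mul_comm` shows that it has the characteristic polynomial of `Dᴴ D`. The
bijection `e` is arbitrary: it only makes `D` indexed by `Fin n`. -/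
theorem singularValue_add_smul (h : IsAnalyticFactorization B ΔB W Wlast S V)
    (e : ((j : Fin k) × Fin (r j)) ≃ Fin n) (t : ℝ) :
    singularValue (B + t • ΔB) =
      singularValue ((blockDiagonal' fun j => S j t).submatrix e.symm e.symm) := by
  apply singularValue_eq_of_charpoly_eq
  set Vt := blockRow fun j => V j t with hVt
  set D := blockDiagonal' fun j => S j t with hD
  have h1 : (B + t • ΔB)ᴴ * (B + t • ΔB) = Vt * (Dᴴ * D) * Vtᴴ := by
    have h2 : B + t • ΔB = blockRow (fun j => W j t) * D * Vtᴴ := by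
      rw [h.factorization, fromCols_mul_fromRows, Matrix.mul_zero, add_zero]
    rw [h2]
    simp only [conjTranspose_mul, conjTranspose_conjTranspose, Matrix.mul_assoc]
    rw [← Matrix.mul_assoc (blockRow fun j => W j t)ᴴ, (h.unitary_W t).gram_left, Matrix.one_mul]
  have h3 : Vt * (Dᴴ * D) * Vtᴴ = Vt.submatrix id e.symm *
      (((D.submatrix e.symm e.symm)ᴴ * D.submatrix e.symm e.symm) *
        (Vt.submatrix id e.symm)ᴴ) := by
    simp only [conjTranspose_submatrix, submatrix_mul_equiv, Matrix.mul_assoc, submatrix_id_id]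
  have h4 : (Vt.submatrix id e.symm)ᴴ * Vt.submatrix id e.symm = 1 := by
    rw [conjTranspose_submatrix, ← submatrix_mul _ _ _ _ _ Function.bijective_id,
      (h.unitary_V t).1, submatrix_one_equiv]
  rw [h1, h3, charpoly_mul_comm, Matrix.mul_assoc, h4, Matrix.mul_one]

theorem sum_singularValue_le (h : IsAnalyticFactorization B ΔB W Wlast S V) (hr : ∑ j, r j = n) :
    ∑ i, (singularValue (B + ΔB) i - singularValue B i) ^ 2 ≤ ∑ j, frobSq (S j 1 - S j 0) := by
  let e : ((j : Fin k) × Fin (r j)) ≃ Fin n := Fintype.equivFinOfCardEq (by simp [hr])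
  have h1 := h.singularValue_add_smul e 1
  have h0 := h.singularValue_add_smul e 0
  rw [one_smul] at h1
  rw [zero_smul, add_zero] at h0
  rw [h1, h0, ← frobSq_blockDiagonal]
  refine (sum_singularValue_sub_sq_le _ _).trans_eq ?_
  have hsub : (blockDiagonal' fun j => S j 1).submatrix e.symm e.symm -
      (blockDiagonal' fun j => S j 0).submatrix e.symm e.symm =
      (blockDiagonal' fun j => S j 1 - S j 0).submatrix e.symm e.symm := by
    change _ = (blockDiagonal' ((fun j => S j 1) - fun j => S j 0)).submatrix e.symm e.symm
    rw [blockDiagonal'_sub]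
    rfl
  rw [hsub, frobSq_submatrix_equiv]

end IsAnalyticFactorization

/-! ### Extended nonnegative weights and truncation -/

theorem enorm_singDown_sub_sq {m n : ℕ} (A C : Matrix (Fin m) (Fin n) ℂ) :
    ‖singDown A - singDown C‖ₑ ^ 2 =
      ENNReal.ofReal (∑ i, (singularValue A i - singularValue C i) ^ 2) := by
  rw [← ofReal_norm, ← ENNReal.ofReal_pow (norm_nonneg _), singDown, singDown, diagonal_sub,
    frobenius_norm_diagonal, EuclideanSpace.norm_sq_eq]
  simp

theorem sq_div_two_mul_ofReal {x : ℝ≥0∞} (hx : x ≠ ∞) (c : ℝ) :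
    x ^ 2 / 2 * ENNReal.ofReal c = ENNReal.ofReal (x.toReal ^ 2 / 2 * c) := by
  rw [ENNReal.ofReal_mul (by positivity), ENNReal.ofReal_div_of_pos two_pos,
    ENNReal.ofReal_pow ENNReal.toReal_nonneg, ENNReal.ofReal_toReal hx, ENNReal.ofReal_ofNat]

theorem tendsto_min_natCast (x : ℝ≥0∞) :
    Filter.Tendsto (fun N : ℕ => min x (N : ℝ≥0∞)) Filter.atTop (nhds x) := by
  simpa using (tendsto_const_nhds (x := x)).min ENNReal.tendsto_nat_nhds_top

/-- Finiteness of `c` is what makes the limit agree with the convention `∞ * 0 = 0` when `x = ∞`. -/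
theorem tendsto_sq_div_two_mul (x : ℝ≥0∞) {c : ℝ≥0∞} (hc : c ≠ ∞) :
    Filter.Tendsto (fun N : ℕ => (min x (N : ℝ≥0∞)) ^ 2 / 2 * c) Filter.atTop
      (nhds (x ^ 2 / 2 * c)) := by
  refine ENNReal.Tendsto.mul_const ?_ (Or.inr hc)
  refine ENNReal.Tendsto.div_const ?_ (Or.inr (by simp))
  exact ENNReal.Tendsto.pow (tendsto_min_natCast x)

/-! ### The minimal gaps as lower bounds on `[0, 1]` -/

section Gaps

variable {k : ℕ} {r : Fin k → ℕ} {S : (j : Fin k) → ℝ → Matrix (Fin (r j)) (Fin (r j)) ℂ}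

theorem rhoMin_le {t : ℝ} (ht : t ∈ Set.Icc (0 : ℝ) 1) {j i : Fin k} (hij : i ≠ j)
    (a : Fin (r j)) (b : Fin (r i)) :
    rhoMin S j ≤ ENNReal.ofReal |singularValue (S j t) a - singularValue (S i t) b| :=
  (iInf₂_le t ht).trans <| (iInf₂_le i hij).trans <|
    (iInf₂_le (singularValue (S j t) a) ⟨a, rfl⟩).trans
      (iInf₂_le (singularValue (S i t) b) ⟨b, rfl⟩)

theorem sigmaBlock_le (t : ℝ) (j : Fin k) (a : Fin (r j)) :
    sigmaBlock S j t ≤ ENNReal.ofReal (singularValue (S j t) a) :=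
  iInf₂_le (singularValue (S j t) a) ⟨a, rfl⟩

theorem sigmaMin_le {t : ℝ} (ht : t ∈ Set.Icc (0 : ℝ) 1) (j : Fin k) (a : Fin (r j)) :
    sigmaMin S ≤ ENNReal.ofReal (singularValue (S j t) a) :=
  (iInf₂_le t ht).trans <| (iInf_le _ j).trans <| sigmaBlock_le t j a

theorem rhoHatMin_le_rhoMin (j : Fin k) : rhoHatMin S j ≤ rhoMin S j :=
  iInf₂_mono fun _ _ => min_le_left _ _

theorem rhoHatMin_le {t : ℝ} (ht : t ∈ Set.Icc (0 : ℝ) 1) (j : Fin k) (a : Fin (r j)) :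
    rhoHatMin S j ≤ ENNReal.ofReal (singularValue (S j t) a) :=
  (iInf₂_le t ht).trans <| (min_le_right _ _).trans <| sigmaBlock_le t j a

end Gaps

/-! ### The bound with possibly infinite weights -/

namespace IsAnalyticFactorization

variable {m n k : ℕ} {r : Fin k → ℕ} {B ΔB : Matrix (Fin m) (Fin n) ℂ}
  {W : (j : Fin k) → ℝ → Matrix (Fin m) (Fin (r j)) ℂ}
  {Wlast : ℝ → Matrix (Fin m) (Fin (m - n)) ℂ}
  {S : (j : Fin k) → ℝ → Matrix (Fin (r j)) (Fin (r j)) ℂ}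
  {V : (j : Fin k) → ℝ → Matrix (Fin n) (Fin (r j)) ℂ}

/-- The bound for weights `q` of the left blocks that are at most the gaps and, unless the last
left block is empty, at most the smallest singular values. -/
theorem enorm_sq_le (h : IsAnalyticFactorization B ΔB W Wlast S V) (hr : ∑ j, r j = n)
    {q : Fin k → ℝ≥0∞} (hq : ∀ j, q j ≤ rhoMin S j)
    (hq' : m - n = 0 ∨ ∀ t ∈ Set.Icc (0 : ℝ) 1, ∀ j a,
      q j ≤ ENNReal.ofReal (singularValue (S j t) a)) :
    ‖singDown (B + ΔB) - singDown B‖ₑ ^ 2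
        + ∑ j, q j ^ 2 / 2 * ‖W j 1 - W j 0‖ₑ ^ 2
        + sigmaMin S ^ 2 / 2 * ‖Wlast 1 - Wlast 0‖ₑ ^ 2
        + ∑ j, rhoMin S j ^ 2 / 2 * ‖V j 1 - V j 0‖ₑ ^ 2
      ≤ ‖ΔB‖ₑ ^ 2 := by
  simp only [enorm_singDown_sub_sq, enorm_sq_eq_ofReal_frobSq]
  -- Each weight is replaced by its minimum with `N`; the real inequality holds for every `N` and
  -- passes to the limit.
  have hlim := (((tendsto_const_nhds (x := ENNReal.ofReal
      (∑ i, (singularValue (B + ΔB) i - singularValue B i) ^ 2))).add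
    (tendsto_finsetSum Finset.univ fun j _ => tendsto_sq_div_two_mul (q j)
      (ENNReal.ofReal_ne_top (r := frobSq (W j 1 - W j 0))))).add
    (tendsto_sq_div_two_mul (sigmaMin S)
      (ENNReal.ofReal_ne_top (r := frobSq (Wlast 1 - Wlast 0))))).add
    (tendsto_finsetSum Finset.univ fun j _ => tendsto_sq_div_two_mul (rhoMin S j)
      (ENNReal.ofReal_ne_top (r := frobSq (V j 1 - V j 0))))
  refine le_of_tendsto' hlim fun N => ?_
  have hfin : ∀ x : ℝ≥0∞, min x (N : ℝ≥0∞) ≠ ∞ := fun x =>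
    ne_top_of_le_ne_top (ENNReal.natCast_ne_top N) (min_le_right _ _)
  have htr : ∀ {x : ℝ≥0∞} {c : ℝ}, 0 ≤ c → x ≤ ENNReal.ofReal c →
      (min x (N : ℝ≥0∞)).toReal ≤ c := fun hc hx =>
    ENNReal.toReal_le_of_le_ofReal hc ((min_le_left _ _).trans hx)
  have hF : ∀ {a b : ℕ} (M : Matrix (Fin a) (Fin b) ℂ), 0 ≤ frobSq M := frobSq_nonneg
  simp only [sq_div_two_mul_ofReal (hfin _)]
  have hnn : ∀ (x : ℝ≥0∞) {a b : ℕ} (M : Matrix (Fin a) (Fin b) ℂ),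
      0 ≤ (min x (N : ℝ≥0∞)).toReal ^ 2 / 2 * frobSq M := fun x _ _ M =>
    mul_nonneg (by positivity) (hF M)
  rw [← ENNReal.ofReal_sum_of_nonneg fun j _ => hnn _ _,
    ← ENNReal.ofReal_sum_of_nonneg fun j _ => hnn _ _]
  have hsum : ∀ f : Fin k → ℝ, (∀ j, 0 ≤ f j) → 0 ≤ ∑ j, f j := fun f hf =>
    Finset.sum_nonneg fun j _ => hf j
  have h0 : 0 ≤ ∑ i, (singularValue (B + ΔB) i - singularValue B i) ^ 2 := by positivity
  have h1 := hsum _ fun j => hnn (q j) (W j 1 - W j 0)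
  have h2 := hsum _ fun j => hnn (rhoMin S j) (V j 1 - V j 0)
  have h3 := hnn (sigmaMin S) (Wlast 1 - Wlast 0)
  rw [← ENNReal.ofReal_add h0 h1, ← ENNReal.ofReal_add (add_nonneg h0 h1) h3,
    ← ENNReal.ofReal_add (add_nonneg (add_nonneg h0 h1) h3) h2]
  refine ENNReal.ofReal_le_ofReal ?_
  have hmain := h.frobSq_blocks_sub_le (p := fun j => (min (rhoMin S j) (N : ℝ≥0∞)).toReal)
    (q := fun j => (min (q j) (N : ℝ≥0∞)).toReal) (s := (min (sigmaMin S) (N : ℝ≥0∞)).toReal)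
    (fun _ => ENNReal.toReal_nonneg) (fun _ => ENNReal.toReal_nonneg) ENNReal.toReal_nonneg
    (fun t ht j i hij a b => htr (abs_nonneg _) (rhoMin_le ht hij a b))
    (fun t ht j i hij a b => htr (abs_nonneg _) ((hq j).trans (rhoMin_le ht hij a b)))
    (hq'.imp id fun H t ht j a => htr (singularValue_nonneg _ _) (H t ht j a))
    (fun t ht j a => htr (singularValue_nonneg _ _) (sigmaMin_le ht j a))
  have := h.sum_singularValue_le hr
  linarith

end IsAnalyticFactorization

end CombinedSVD

theorem mainTheorem4 {m n k : ℕ} (hmn : n ≤ m) (r : Fin k → ℕ) (hr : ∑ j, r j = n)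
    (B ΔB : Matrix (Fin m) (Fin n) ℂ)
    (W : (j : Fin k) → ℝ → Matrix (Fin m) (Fin (r j)) ℂ)
    (Wlast : ℝ → Matrix (Fin m) (Fin (m - n)) ℂ)
    (S : (j : Fin k) → ℝ → Matrix (Fin (r j)) (Fin (r j)) ℂ)
    (V : (j : Fin k) → ℝ → Matrix (Fin n) (Fin (r j)) ℂ)
    (h : CombinedSVD.IsAnalyticFactorization B ΔB W Wlast S V) :
    (‖CombinedSVD.singDown (B + ΔB) - CombinedSVD.singDown B‖ₑ ^ 2
        + ∑ j, CombinedSVD.rhoHatMin S j ^ 2 / 2 * ‖W j 1 - W j 0‖ₑ ^ 2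
        + CombinedSVD.sigmaMin S ^ 2 / 2 * ‖Wlast 1 - Wlast 0‖ₑ ^ 2
        + ∑ j, CombinedSVD.rhoMin S j ^ 2 / 2 * ‖V j 1 - V j 0‖ₑ ^ 2
      ≤ ‖ΔB‖ₑ ^ 2) ∧
    (m = n →
      ‖CombinedSVD.singDown (B + ΔB) - CombinedSVD.singDown B‖ₑ ^ 2
        + ∑ j, CombinedSVD.rhoMin S j ^ 2 / 2 *
            (‖W j 1 - W j 0‖ₑ ^ 2 + ‖V j 1 - V j 0‖ₑ ^ 2)
      ≤ ‖ΔB‖ₑ ^ 2) := by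
  refine ⟨h.enorm_sq_le hr CombinedSVD.rhoHatMin_le_rhoMin
    (Or.inr fun t ht j a => CombinedSVD.rhoHatMin_le ht j a), fun hmn' => ?_⟩
  -- For `m = n` the full gap `ρ_{j,min}` is an admissible left weight, and the nonnegative
  -- `W_{k+1}` term is dropped.
  refine le_trans ?_ (h.enorm_sq_le hr (fun _ => le_rfl) (Or.inl (by omega)))
  simp only [mul_add, Finset.sum_add_distrib]
  rw [← add_assoc]
  exact add_le_add le_self_add le_rfl
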